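/- A represented space is a set $X$ with a surjective partial map $\delta_X:\subseteq\mathbb{N}^{\mathbb{N}}\to X$ (if $\delta_X(p)=x$, then $p$ is a name of $x$); it is endowed with the final topology $\{U\subseteq X:\delta_X^{-1}(U)\text{ is open in }\mathrm{dom}(\delta_X)\}$. A (partial, possibly multivalued) map $f$ between represented spaces is computable if some computable partial function on $\mathbb{N}^{\mathbb{N}}$ maps every name of every $x\in\mathrm{dom}(f)$ to a name of some element of $f(x)$. A computable embedding is an injective computable map whose partial inverse is computable. $\mathcal{O}(X)$ denotes the represented space of open subsets of $X$, where a name of $U$ is a name of the characteristic function $X\to\mathbb{S}$ of $U$ in the function space of continuous maps into the Sierpiński space. $\mathcal{K}_-(X)$ denotes the represented space of saturated compact $K\subseteq X$ (saturated means that $K$ is the intersection of its open supersets), where a name of $K$ is a name of the open set $\{U\in\mathcal{O}(X):K\subseteq U\}\in\mathcal{O}\mathcal{O}(X)$. $\mathcal{A}_+(X)$ denotes the represented space of closed $A\subseteq X$, where a name of $A$ is a name of $\{U\in\mathcal{O}(X):A\cap U\neq\emptyset\}\in\mathcal{O}\mathcal{O}(X)$. Let $X$ and $Y$ be represented spaces.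 A map $B:Y\to\mathcal{O}(X)$, $y\mapsto B_y$, is a computable presubbase of $X$ if its transpose $x\mapsto\{y\in Y:x\in B_y\}$ is a well-defined computable embedding $X\to\mathcal{O}(Y)$. It is a computable prebase of $X$ if it is a computable presubbase, $X=\bigcup_{y\in Y}B_y$, and there is a computable (total) multivalued map $R:\mathcal{K}_-(Y)\rightrightarrows\mathcal{A}_+(Y)$ such that $\bigcap_{y\in K}B_y=\bigcup_{y\in A}B_y$ for all $K\in\mathcal{K}_-(Y)$ and $A\in R(K)$. Empty intersections are understood to be $X$. Proposition. Let $X$ and $Y$ be represented spaces and let $B:Y\to\mathcal{O}(X)$ be a computable presubbase of $X$. Then $$\textstyle\bigcap_{\mathcal{K}}B:\mathcal{K}_-(Y)\to\mathcal{O}(X),\quad K\mapsto\bigcap_{y\in K}B_y,$$ is well-defined (that is, $\bigcap_{y\in K}B_y$ is open in $X$ for every $K\in\mathcal{K}_-(Y)$), and it is a computable prebase of $X$. -/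

import Mathlib

open Filter Topology

namespace RepSp

/-- Baire space, with the product topology of the discrete topologies. -/
abbrev Baire : Type := ℕ → ℕ

/-- The question, coded as a natural number, "what is the `n`-th digit of the output,
given that the input begins with the `k` digits `q 0, …, q (k - 1)`?" -/
def query (n : ℕ) (q : Baire) (k : ℕ) : ℕ :=
  Nat.pair n (Encodable.encode ((List.range k).map q))

open Classical in
/-- The partial continuous function on Baire space with associate `p` (application in Kleene's
second algebra). The answer `0` means "read more input" and the answer `m + 1` means "the digit
is `m`". The value is defined if all digits of the output are eventually produced. -/
noncomputable def kleeneApp (p : Baire) : Baire →. Baire := fun q =>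
  ⟨∀ n, ∃ k, p (query n q k) ≠ 0, fun h n => p (query n q (Nat.find (h n))) - 1⟩

/-- Computability of partial functions on Baire space: the digits of the output are computed
from finite prefixes of the input by a computable associate. -/
def TypeTwoComputable (F : Baire →. Baire) : Prop :=
  ∃ p : ℕ → ℕ, Computable p ∧ ∀ q r, r ∈ F q → r ∈ kleeneApp p q

/-- A represented space: a set `X` with a partial surjection from Baire space onto `X`, given by
its graph; `IsName p x` says that the partial surjection is defined at `p` with value `x`. -/
class Represented (X : Type*) where
  IsName : Baire → X → Prop
  unique : ∀ {p x y}, IsName p x → IsName p y → x = y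
  surj : ∀ x, ∃ p, IsName p x

open Represented (IsName)

section Maps

variable {X Y : Type*} [Represented X] [Represented Y]

/-- `F` realizes the multivalued partial map `f`, whose domain consists of all points `x`
for which `f x` is non-empty. -/
def Realizes (F : Baire →. Baire) (f : X → Set Y) : Prop :=
  ∀ p x, IsName p x → (f x).Nonempty → ∃ q ∈ F p, ∃ y ∈ f x, IsName q y

/-- A multivalued partial map is computable if it has a computable realizer. -/
def IsComputableMulti (f : X → Set Y) : Prop :=
  ∃ F, TypeTwoComputable F ∧ Realizes F f

/-- A (singlevalued, total) map is computable if it has a computable realizer. -/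
def IsComputableMap (f : X → Y) : Prop :=
  IsComputableMulti fun x => {f x}

/-- An injective map such that it and its partial inverse are computable. -/
def IsComputableEmbedding (f : X → Y) : Prop :=
  Function.Injective f ∧ IsComputableMap f ∧ IsComputableMulti fun y => {x | f x = y}

end Maps

section FinalTopology

variable (X : Type*) [Represented X]

/-- The domain of the representation. -/
def names : Set Baire := {p | ∃ x : X, IsName p x}

/-- The representation as a total map on its domain. -/
noncomputable def decodeName (p : names X) : X := p.2.choose

/-- The final topology of a represented space. -/
@[reducible] noncomputable def finalTopology : TopologicalSpace X :=
  TopologicalSpace.coinduced (decodeName X) inferInstance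

variable {X}

lemma decodeName_eq {p : Baire} {x : X} (h : IsName p x) : decodeName X ⟨p, x, h⟩ = x :=
  Represented.unique (Exists.choose_spec (⟨x, h⟩ : ∃ x : X, IsName p x)) h

lemma isOpen_final_iff {U : Set X} : IsOpen[finalTopology X] U ↔
    ∀ p x, IsName p x → x ∈ U → ∀ᶠ p' in 𝓝 p, ∀ x' : X, IsName p' x' → x' ∈ U := by
  rw [finalTopology, isOpen_coinduced, isOpen_iff_mem_nhds]
  constructor
  · intro h p x hp hx
    have h1 := h ⟨p, x, hp⟩ (by simpa [decodeName_eq hp] using hx)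
    rw [nhds_subtype, mem_comap] at h1
    obtain ⟨t, ht, hts⟩ := h1
    filter_upwards [ht] with p' hp' x' hx'
    have h2 := hts (show (⟨p', x', hx'⟩ : names X) ∈ _ from hp')
    simpa [decodeName_eq hx'] using h2
  · rintro h ⟨p, x, hp⟩ hx
    have hx' : x ∈ U := by simpa [decodeName_eq hp] using hx
    rw [nhds_subtype, mem_comap]
    refine ⟨_, h p x hp hx', ?_⟩
    rintro ⟨p', x', hp'⟩ h'
    have h2 := h' x' hp'
    simpa [decodeName_eq hp'] using h2

end FinalTopology

/-- The Sierpiński space, with `True` as its open point. -/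
def Sierpinski : Type := Prop

/-- The zero sequence is the only name of the closed point. -/
instance : Represented Sierpinski where
  IsName p s := (s : Prop) ↔ ∃ n, p n ≠ 0
  unique h h' := propext (h.trans h'.symm)
  surj s := by
    rcases Classical.em s with hs | hs
    · exact ⟨fun _ => 1, fun _ => ⟨0, one_ne_zero⟩, fun _ => hs⟩
    · exact ⟨fun _ => 0, fun h => absurd h hs, fun ⟨_, h⟩ => absurd rfl h⟩

/-- The characteristic function of a set. -/
def chi {X : Type*} (U : Set X) : X → Sierpinski := fun x => (x ∈ U : Prop)

lemma kleeneApp_eventually {p q r : Baire} (hr : r ∈ kleeneApp p q) (n : ℕ) :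
    ∀ᶠ z : Baire × Baire in 𝓝 p ×ˢ 𝓝 q, ∀ r' ∈ kleeneApp z.1 z.2, r' n = r n := by
  classical
  obtain ⟨h, rfl⟩ := hr
  have hp : ∀ m, ∀ᶠ p' : Baire in 𝓝 p, p' m = p m := fun m =>
    (continuous_apply m).continuousAt.eventually_mem
      (discreteTopology_iff_singleton_mem_nhds.1 inferInstance (p m))
  have hq : ∀ m, ∀ᶠ q' : Baire in 𝓝 q, q' m = q m := fun m =>
    (continuous_apply m).continuousAt.eventually_mem
      (discreteTopology_iff_singleton_mem_nhds.1 inferInstance (q m))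
  set k := Nat.find (h n) with hk
  have hp1 : ∀ᶠ p' : Baire in 𝓝 p, ∀ j ∈ Finset.range (k + 1),
      p' (query n q j) = p (query n q j) :=
    (Finset.eventually_all _).2 fun j _ => hp _
  have hq1 : ∀ᶠ q' : Baire in 𝓝 q, ∀ j ∈ Finset.range k, q' j = q j :=
    (Finset.eventually_all _).2 fun j _ => hq _
  filter_upwards [hp1.prod_mk hq1] with z hz
  obtain ⟨hz1, hz2⟩ := hz
  have hqu : ∀ j ≤ k, query n z.2 j = query n q j := by
    intro j hj
    unfold query
    congr 2
    refine List.map_congr_left fun i hi => hz2 i ?_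
    rw [List.mem_range] at hi
    exact Finset.mem_range.2 (by omega)
  have hpq : ∀ j ≤ k, z.1 (query n z.2 j) = p (query n q j) := fun j hj => by
    rw [hqu j hj, hz1 j (Finset.mem_range.2 (by omega))]
  rintro r' ⟨h', rfl⟩
  have hfind : Nat.find (h' n) = k := by
    rw [Nat.find_eq_iff]
    refine ⟨by rw [hpq k le_rfl]; exact Nat.find_spec (h n), fun j hj => ?_⟩
    rw [hpq j hj.le]
    exact Nat.find_min (h n) hj
  change z.1 (query n z.2 (Nat.find (h' n))) - 1 = p (query n q (Nat.find (h n))) - 1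
  rw [hfind, hpq k le_rfl]

section Hyperspaces

variable {X : Type*} [Represented X]

lemma exists_chi_name {U : Set X} (hU : IsOpen[finalTopology X] U) :
    ∃ p : Baire, Realizes (kleeneApp p) (fun x => {chi U x}) := by
  classical
  let p : Baire := fun m =>
    let n := (Nat.unpair m).1
    let w := (Encodable.decode (α := List ℕ) (Nat.unpair m).2).getD []
    if w.length < n then 0
    else if ∀ (q : Baire) (x : X), IsName q x → (List.range w.length).map q = w → x ∈ U then 2
    else 1
  have hp : ∀ n q k, p (query n q k) = if k < n then 0
    else if ∀ (q' : Baire) (x : X), IsName q' x →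
      (List.range k).map q' = (List.range k).map q → x ∈ U then 2 else 1 := by
    intro n q k
    simp only [p, query, Nat.unpair_pair, Encodable.encodek, Option.getD_some, List.length_map,
      List.length_range]
  refine ⟨p, fun q x hq _ => ?_⟩
  have hdom : ∀ n, ∃ k, p (query n q k) ≠ 0 := fun n => ⟨n, by
    rw [hp, if_neg (lt_irrefl n)]; split_ifs <;> simp⟩
  have hfind : ∀ n, Nat.find (hdom n) = n := fun n => by
    rw [Nat.find_eq_iff]
    refine ⟨by rw [hp, if_neg (lt_irrefl n)]; split_ifs <;> simp, fun j hj => ?_⟩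
    rw [hp, if_pos hj]; simp
  refine ⟨_, ⟨hdom, rfl⟩, _, rfl, ?_⟩
  change x ∈ U ↔ ∃ n, p (query n q (Nat.find (hdom n))) - 1 ≠ 0
  simp only [hfind]
  constructor
  · intro hx
    have h1 := isOpen_final_iff.1 hU q x hq hx
    obtain ⟨_, ⟨y, n, rfl⟩, hqy, hsub⟩ :=
      (PiNat.isTopologicalBasis_cylinders (fun _ : ℕ => ℕ)).mem_nhds_iff.1 h1
    refine ⟨n, ?_⟩
    rw [hp, if_neg (lt_irrefl n), if_pos]
    · simp
    · intro q' x' hq' he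
      refine hsub ?_ x' hq'
      rw [PiNat.mem_cylinder_iff] at hqy ⊢
      intro i hi
      rw [← hqy i hi]
      exact List.map_inj_left.1 he i (List.mem_range.2 hi)
  · rintro ⟨n, hn⟩
    rw [hp, if_neg (lt_irrefl n)] at hn
    split_ifs at hn with h
    · exact h q x hq rfl
    · simp at hn

variable (X)

/-- The space `𝒪(X)` of open subsets of a represented space (in its final topology). -/
@[ext] structure OO where
  carrier : Set X
  isOpen : IsOpen[finalTopology X] carrier

variable {X}

instance : Membership X (OO X) := ⟨fun U x => x ∈ U.carrier⟩

/-- A name of an open set `U` is an associate of a realizer of the characteristic function of `U`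
as a map into the Sierpiński space, i.e. a name of this function in the function space. -/
instance : Represented (OO X) where
  IsName p U := Realizes (kleeneApp p) (fun x => {chi U.carrier x})
  unique {p U V} hU hV := by
    refine OO.ext (Set.ext fun x => ?_)
    obtain ⟨q, hq⟩ := Represented.surj x
    obtain ⟨r, hr, _, rfl, h⟩ := hU q x hq ⟨_, rfl⟩
    obtain ⟨r', hr', _, rfl, h'⟩ := hV q x hq ⟨_, rfl⟩
    rw [Part.mem_unique hr' hr] at h'
    exact h.trans h'.symm
  surj U := exists_chi_name U.isOpen

lemma eventually_mem {p q : Baire} {U : OO X} {x : X} (hp : IsName p U) (hq : IsName q x)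
    (hx : x ∈ U) : ∀ᶠ z : Baire × Baire in 𝓝 p ×ˢ 𝓝 q,
      ∀ (V : OO X) (y : X), IsName z.1 V → IsName z.2 y → y ∈ V := by
  obtain ⟨r, hr, _, rfl, h⟩ := hp q x hq ⟨_, rfl⟩
  obtain ⟨n, hn⟩ := h.1 hx
  filter_upwards [kleeneApp_eventually hr n] with z hz V y hV hy
  obtain ⟨r', hr', _, rfl, h'⟩ := hV z.2 y hy ⟨_, rfl⟩
  exact h'.2 ⟨n, by rw [hz r' hr']; exact hn⟩

lemma isOpen_filter {K : Set X} (hK : @IsCompact X (finalTopology X) K) :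
    IsOpen[finalTopology (OO X)] {U : OO X | ∀ x ∈ K, x ∈ U} := by
  rw [isOpen_final_iff]
  intro p U hp hKU
  by_contra hcon
  obtain ⟨ps, hps, hps'⟩ := exists_seq_forall_of_frequently (not_eventually.1 hcon)
  simp only [not_forall, Set.mem_ofPred_eq] at hps'
  choose Us hUs y hyK hyU using hps'
  let V : ℕ → Set X := fun k => {x | x ∈ U ∧ ∀ j, k ≤ j → x ∈ Us j}
  have key : ∀ x ∈ U, ∀ q, IsName q x → ∃ J, ∀ᶠ q' in 𝓝 q, ∀ y : X, IsName q' y →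
      ∀ j, J ≤ j → y ∈ Us j := by
    intro x hx q hq
    obtain ⟨pa, hpa, pb, hpb, hab⟩ := eventually_prod_iff.1 (eventually_mem hp hq hx)
    obtain ⟨J, hJ⟩ := eventually_atTop.1 (hps.eventually hpa)
    refine ⟨J, ?_⟩
    filter_upwards [hpb] with q' hq' y hy j hj
    exact hab (hJ j hj) hq' _ _ (hUs j) hy
  have hVo : ∀ k, IsOpen[finalTopology X] (V k) := by
    intro k
    rw [isOpen_final_iff]
    rintro q x hq ⟨hxU, hxj⟩
    obtain ⟨J, hJ⟩ := key x hxU q hq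
    have h2 : ∀ᶠ q' in 𝓝 q, ∀ j ∈ Finset.range J, k ≤ j → ∀ y : X, IsName q' y → y ∈ Us j := by
      refine (Finset.eventually_all _).2 fun j _ => ?_
      by_cases hkj : k ≤ j
      · filter_upwards [isOpen_final_iff.1 (Us j).isOpen q x hq (hxj j hkj)] with q' hq' _ y hy
        exact hq' y hy
      · exact Eventually.of_forall fun _ h => absurd h hkj
    filter_upwards [hJ, h2, isOpen_final_iff.1 U.isOpen q x hq hxU] with q' h3 h4 h5 y hy
    refine ⟨h5 y hy, fun j hj => ?_⟩
    rcases le_or_gt J j with h | h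
    · exact h3 y hy j h
    · exact h4 j (Finset.mem_range.2 h) hj y hy
  let _ := finalTopology X
  obtain ⟨k, hk⟩ := hK.elim_directed_cover V hVo (fun x hx => by
      obtain ⟨q, hq⟩ := Represented.surj x
      obtain ⟨J, hJ⟩ := key x (hKU x hx) q hq
      exact Set.mem_iUnion.2 ⟨J, hKU x hx, hJ.self_of_nhds x hq⟩)
    (Monotone.directed_le fun a b hab x hx => ⟨hx.1, fun j hj => hx.2 j (hab.trans hj)⟩)
  exact hyU k ((hk (hyK k)).2 k le_rfl)

lemma isOpen_trace (A : Set X) :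
    IsOpen[finalTopology (OO X)] {U : OO X | ∃ x ∈ A, x ∈ U} := by
  rw [isOpen_final_iff]
  rintro p U hp ⟨x, hxA, hxU⟩
  obtain ⟨q, hq⟩ := Represented.surj x
  filter_upwards [(eventually_mem hp hq hxU).curry] with p' hp' V hV
  exact ⟨x, hxA, hp'.self_of_nhds V x hV hq⟩

variable (X)

/-- The space `𝒦₋(X)` of saturated compact subsets of a represented space, where a set is
saturated if it contains every point that lies in all its open supersets. -/
@[ext] structure KK where
  carrier : Set X
  isCompact : @IsCompact X (finalTopology X) carrier
  saturated : ∀ x, (∀ U, IsOpen[finalTopology X] U → carrier ⊆ U → x ∈ U) → x ∈ carrier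

/-- The space `𝒜₊(X)` of closed subsets of a represented space. -/
@[ext] structure AA where
  carrier : Set X
  isClosed : IsClosed[finalTopology X] carrier

variable {X}

instance : Membership X (KK X) := ⟨fun K x => x ∈ K.carrier⟩

instance : Membership X (AA X) := ⟨fun A x => x ∈ A.carrier⟩

/-- The open set of all `U ∈ 𝒪(X)` with `K ⊆ U`. -/
def FF (K : KK X) : OO (OO X) := ⟨{U | ∀ x ∈ K, x ∈ U}, isOpen_filter K.isCompact⟩

/-- The open set of all `U ∈ 𝒪(X)` with `A ∩ U ≠ ∅`. -/
def TT (A : AA X) : OO (OO X) := ⟨{U | ∃ x ∈ A, x ∈ U}, isOpen_trace A.carrier⟩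

lemma FF_injective : Function.Injective (FF (X := X)) := by
  have key : ∀ K L : KK X, FF K = FF L → K.carrier ⊆ L.carrier := by
    intro K L h x hx
    refine L.saturated x fun U hU hLU => ?_
    have h1 : (⟨U, hU⟩ : OO X) ∈ (FF L).carrier := fun y hy => hLU hy
    rw [← h] at h1
    exact h1 x hx
  exact fun K L h => KK.ext ((key K L h).antisymm (key L K h.symm))

lemma TT_injective : Function.Injective (TT (X := X)) := by
  have key : ∀ A B : AA X, TT A = TT B → A.carrier ⊆ B.carrier := by
    intro A B h x hx
    by_contra hxB
    have h1 : (⟨B.carrierᶜ, B.isClosed.isOpen_compl⟩ : OO X) ∈ (TT A).carrier := ⟨x, hx, hxB⟩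
    rw [h] at h1
    obtain ⟨y, hy, hy'⟩ := h1
    exact hy' hy
  exact fun A B h => AA.ext ((key A B h).antisymm (key B A h.symm))

/-- A saturated compact set `K` is represented by the universal quantifier
`∀_K : 𝒪(X) → 𝕊`, the characteristic function of `FF K`. -/
instance : Represented (KK X) where
  IsName p K := IsName p (FF K)
  unique h h' := FF_injective (Represented.unique h h')
  surj K := Represented.surj (FF K)

/-- A closed set `A` is represented by the existential quantifier
`∃_A : 𝒪(X) → 𝕊`, the characteristic function of `TT A`. -/
instance : Represented (AA X) where
  IsName p A := IsName p (TT A)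
  unique h h' := TT_injective (Represented.unique h h')
  surj A := Represented.surj (TT A)

end Hyperspaces

section Bases

variable {X Y : Type*} [Represented X] [Represented Y]

/-- `B` is a computable presubbase of `X`: its transpose `x ↦ {y | x ∈ B y}` is well-defined as
a map from `X` to `𝒪(Y)`, and it is a computable embedding. -/
def IsComputablePresubbase (B : Y → OO X) : Prop :=
  ∃ h : ∀ x : X, IsOpen[finalTopology Y] {y | x ∈ B y},
    IsComputableEmbedding (fun x => (⟨{y | x ∈ B y}, h x⟩ : OO Y))

/-- `B` is a computable prebase of `X`: it is a computable presubbase that covers `X`, and some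
(total) computable multivalued map turns saturated compact sets `K` of indices into closed sets
`A` of indices such that the intersection over `K` is the union over `A`. -/
def IsComputablePrebase (B : Y → OO X) : Prop :=
  IsComputablePresubbase B ∧
  (∃ R : KK Y → Set (AA Y), (∀ K, (R K).Nonempty) ∧ IsComputableMulti R ∧
    ∀ K, ∀ A ∈ R K, ⋂ y ∈ K, (B y).carrier = ⋃ y ∈ A, (B y).carrier) ∧
  ⋃ y, (B y).carrier = Set.univ

end Bases

end RepSp

open RepSp

/-! Let `e : X → 𝒪(Y)` be the transpose of `B`. A point `x` lies in the intersection over `K` iff `K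
⊆ e x`, so the new transpose is `box ∘ e`, where `box U` is the set of all `K ⊆ U`. The intersection
over `K` is open, being the preimage of `FF K` under `e`. The map `box` is a computable embedding,
since `y ∈ U` iff the saturation of `{y}` is in `box U`; this yields `isComputableEmbedding_box`.

The empty compact set gives the covering. For a compact `𝒦` of compact sets, intersecting over all
`K ∈ 𝒦` is intersecting over their union, which is compact with saturation `L = KK.union 𝒦`. An open
set meets the closure of `{L}` iff it contains `L`, so this closure is the required closed set, and
it depends computably on `𝒦` (`isComputableMap_closure_union`).

On names only two operations occur. `swap` exchanges function and argument; it produces names of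
`box U`, of saturations of points and of closures of points. `preswap` precomposes with `swap`; it
recovers `U` from `box U` and computes the union of `𝒦`. The work on associates shows that both
operations, and composition, are computable. -/

namespace RepSp

open RepSp.Represented (IsName)

/-! ### Calculus of associates in Kleene's second algebra -/

section Associates

/-- The list of the first `k` digits of `q`. -/
def pre (q : Baire) (k : ℕ) : List ℕ := (List.range k).map q

/-- The extension of a list by zeros. -/
def pad (w : List ℕ) : Baire := fun i => w.getD i 0

/-- The list coded by the second component of a number. -/
def dec (m : ℕ) : List ℕ := (Encodable.decode (α := List ℕ) m.unpair.2).getD []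

/-- The first non-zero answer of `p` to the queries about the `n`-th digit of the output on input
`q` that use at most `k` digits of `q`; it is `0` if there is none. -/
def lookup (p q : Baire) (n k : ℕ) : ℕ :=
  Nat.rec (p (query n q 0)) (fun j v => bif v == 0 then p (query n q (j + 1)) else v) k

@[simp] lemma length_pre (q : Baire) (k : ℕ) : (pre q k).length = k := by simp [pre]

lemma pre_succ (q : Baire) (k : ℕ) : pre q (k + 1) = pre q k ++ [q k] := by
  simp [pre, List.range_succ]

lemma pre_congr {q q' : Baire} {k : ℕ} (h : ∀ i < k, q i = q' i) : pre q k = pre q' k :=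
  List.map_congr_left fun i hi => h i (List.mem_range.1 hi)

lemma pad_pre_of_lt (q : Baire) {i k : ℕ} (h : i < k) : pad (pre q k) i = q i := by
  simp [pad, pre, h]

lemma pad_pre_of_le (q : Baire) {i k : ℕ} (h : k ≤ i) : pad (pre q k) i = 0 := by
  simp [pad, pre, h]

lemma query_eq (n : ℕ) (q : Baire) (k : ℕ) :
    query n q k = Nat.pair n (Encodable.encode (pre q k)) := rfl

lemma query_congr {q q' : Baire} {k : ℕ} (n : ℕ) (h : ∀ i < k, q i = q' i) :
    query n q k = query n q' k := by rw [query_eq, query_eq, pre_congr h]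

@[simp] lemma unpair_query (n : ℕ) (q : Baire) (k : ℕ) : (query n q k).unpair.1 = n := by
  simp [query]

@[simp] lemma dec_query (n : ℕ) (q : Baire) (k : ℕ) : dec (query n q k) = pre q k := by
  simp [query, dec, pre]

lemma le_query (n : ℕ) (q : Baire) (k : ℕ) : k ≤ query n q k := by
  have h := (Encodable.length_le_encode (pre q k)).trans (Nat.right_le_pair n _)
  rwa [length_pre] at h

lemma encode_le_encode_append (l l' : List ℕ) :
    Encodable.encode l ≤ Encodable.encode (l ++ l') := by
  induction l with
  | nil => simp
  | cons a l ih =>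
    simp only [List.cons_append, Encodable.encode_list_cons, Nat.succ_eq_add_one]
    rcases ih.eq_or_lt with h | h
    · rw [h]
    · exact Nat.succ_le_succ (Nat.pair_lt_pair_right _ h).le

/-- Pairing is monotone in the component that holds the tail of a list, so longer prefixes have
larger codes. Hence an associate cut off at one query is cut off at all later queries about the same
digit of the output. -/
lemma query_mono (n : ℕ) (q : Baire) : Monotone (query n q) := by
  refine monotone_nat_of_le_succ fun k => ?_
  rw [query_eq, query_eq, pre_succ]
  rcases (encode_le_encode_append (pre q k) [q k]).eq_or_lt with h | h
  · rw [h]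
  · exact (Nat.pair_lt_pair_right _ h).le

lemma lookup_succ (p q : Baire) (n k : ℕ) : lookup p q n (k + 1) =
    if lookup p q n k = 0 then p (query n q (k + 1)) else lookup p q n k := by
  change (bif lookup p q n k == 0 then p (query n q (k + 1)) else lookup p q n k) = _
  simp [Bool.cond_eq_ite]

lemma lookup_eq_zero {p q : Baire} {n k : ℕ} (h : ∀ j ≤ k, p (query n q j) = 0) :
    lookup p q n k = 0 := by
  induction k with
  | zero => exact h 0 le_rfl
  | succ k ih => rw [lookup_succ, if_pos (ih fun j hj => h j (by omega)), h _ le_rfl]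

lemma lookup_eq {p q : Baire} {n j k : ℕ} (h : ∀ i < j, p (query n q i) = 0)
    (hj : p (query n q j) ≠ 0) (hjk : j ≤ k) : lookup p q n k = p (query n q j) := by
  induction k, hjk using Nat.le_induction with
  | base =>
    cases j with
    | zero => rfl
    | succ j => rw [lookup_succ, if_pos (lookup_eq_zero fun i hi => h i (by omega))]
  | succ k _ ih => rw [lookup_succ, if_neg (by rwa [ih]), ih]

lemma exists_first_answer {p q r : Baire} (hr : r ∈ kleeneApp p q) (n : ℕ) :
    ∃ j, (∀ i < j, p (query n q i) = 0) ∧ p (query n q j) = r n + 1 := by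
  classical
  obtain ⟨h, rfl⟩ := hr
  refine ⟨Nat.find (h n), fun i hi => not_not.1 (Nat.find_min (h n) hi), ?_⟩
  exact (Nat.succ_pred_eq_of_ne_zero (Nat.find_spec (h n))).symm

/-- This criterion asks that no answer be wrong, late ones included, so the first non-zero answer
never has to be located. -/
lemma mem_kleeneApp {p q r : Baire}
    (h : ∀ n, (∀ k, p (query n q k) = 0 ∨ p (query n q k) = r n + 1) ∧
      ∃ k, p (query n q k) = r n + 1) : r ∈ kleeneApp p q := by
  classical
  have hd : ∀ n, ∃ k, p (query n q k) ≠ 0 := fun n => by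
    obtain ⟨k, hk⟩ := (h n).2
    exact ⟨k, by omega⟩
  refine ⟨hd, funext fun n => ?_⟩
  change p (query n q (Nat.find (hd n))) - 1 = r n
  have h1 := Nat.find_spec (hd n)
  have h2 := (h n).1 (Nat.find (hd n))
  omega

/-- Soundness of searching with truncated data. Before the first true answer `p'` only says `0`. If
`p'` is cut off at that answer, monotonicity of the queries keeps it silent afterwards, so no false
digit can appear. -/
lemma lookup_approx {p p' q q' r : Baire} (hr : r ∈ kleeneApp p q) {n k : ℕ}
    (hp : ∀ m, p' m = p m ∨ ∀ m' ≥ m, p' m' = 0) (hq : ∀ i < k, q' i = q i) :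
    lookup p' q' n k = 0 ∨ lookup p' q' n k = r n + 1 := by
  obtain ⟨j, hj, hjr⟩ := exists_first_answer hr n
  have hqu : ∀ i ≤ k, query n q' i = query n q i := fun i hi =>
    query_congr n fun i' hi' => hq i' (by omega)
  have hz : ∀ i < j, p' (query n q i) = 0 := fun i hi =>
    (hp (query n q i)).elim (fun h => h.trans (hj i hi)) fun h => h _ le_rfl
  rcases lt_or_ge k j with hkj | hjk
  · exact .inl (lookup_eq_zero fun i hi => by rw [hqu i hi, hz i (by omega)])
  rcases hp (query n q j) with h | h
  · right
    rw [lookup_eq (j := j) (fun i hi => by rw [hqu i (by omega), hz i hi])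
      (by rw [hqu j hjk, h, hjr]; simp) hjk, hqu j hjk, h, hjr]
  · refine .inl (lookup_eq_zero fun i hi => ?_)
    rw [hqu i hi]
    rcases lt_or_ge i j with hij | hji
    · exact hz i hij
    · exact h _ (query_mono n q hji)

/-- Completeness of the search: one bound serves for the digits of the associate, the digits of the
input and the length of the search. -/
lemma exists_lookup_eq {p q r : Baire} (hr : r ∈ kleeneApp p q) (n : ℕ) :
    ∃ J, ∀ p' q' : Baire, ∀ k ≥ J, (∀ m < J, p' m = p m) → (∀ i < J, q' i = q i) →
      lookup p' q' n k = r n + 1 := by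
  obtain ⟨j, hj, hjr⟩ := exists_first_answer hr n
  -- By `query_mono` this exceeds every index consulted up to the first answer, and by `le_query` it
  -- exceeds `j`.
  refine ⟨query n q j + 1, fun p' q' k hk hp hq => ?_⟩
  have hjq := le_query n q j
  have hqu : ∀ i ≤ j, p' (query n q' i) = p (query n q i) := fun i hi => by
    rw [query_congr (q' := q) n fun i' hi' => hq i' (by omega)]
    exact hp _ (Nat.lt_succ_of_le (query_mono n q hi))
  rw [lookup_eq (j := j) (fun i hi => by rw [hqu i hi.le, hj i hi])
    (by rw [hqu j le_rfl, hjr]; simp) (by omega), hqu j le_rfl, hjr]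

lemma pad_pre_approx (p : Baire) (M m : ℕ) :
    pad (pre p M) m = p m ∨ ∀ m' ≥ m, pad (pre p M) m' = 0 := by
  rcases lt_or_ge m M with h | h
  · exact .inl (pad_pre_of_lt p h)
  · exact .inr fun m' hm' => pad_pre_of_le p (h.trans hm')

/-- An associate of the function that maps `k` to the application of `k` to `u`. -/
def swap (u : Baire) : Baire := fun m =>
  lookup (pad (dec m)) (pad (pre u m)) m.unpair.1 (dec m).length

lemma mem_kleeneApp_swap {k u r : Baire} (h : r ∈ kleeneApp k u) : r ∈ kleeneApp (swap u) k := by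
  refine mem_kleeneApp fun n => ⟨fun j => ?_, ?_⟩
  · simp only [swap, unpair_query, dec_query, length_pre]
    exact lookup_approx h (pad_pre_approx k j) fun i hi =>
      pad_pre_of_lt u (hi.trans_le (le_query n k j))
  · obtain ⟨J, hJ⟩ := exists_lookup_eq h n
    refine ⟨J, ?_⟩
    simp only [swap, unpair_query, dec_query, length_pre]
    exact hJ _ _ J le_rfl (fun m hm => pad_pre_of_lt k hm) fun i hi =>
      pad_pre_of_lt u (hi.trans_le (le_query n k J))

/-- Causality, the form required by `causalAssoc`. -/
lemma swap_congr {u u' : Baire} {m : ℕ} (h : ∀ i < m, u i = u' i) : swap u m = swap u' m := by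
  simp only [swap, pre_congr h]

/-- An associate of the function that maps `y` to the application of `v` to `swap y`. -/
def preswap (v : Baire) : Baire := fun m =>
  lookup (pad (pre v m)) (swap (pad (dec m))) m.unpair.1 (dec m).length

lemma mem_kleeneApp_preswap {v y r : Baire} (h : r ∈ kleeneApp v (swap y)) :
    r ∈ kleeneApp (preswap v) y := by
  have hs : ∀ j, ∀ i < j, swap (pad (pre y j)) i = swap y i := fun j i hi =>
    swap_congr fun i' hi' => pad_pre_of_lt y (hi'.trans hi)
  refine mem_kleeneApp fun n => ⟨fun j => ?_, ?_⟩
  · simp only [preswap, unpair_query, dec_query, length_pre]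
    exact lookup_approx h (pad_pre_approx v _) (hs j)
  · obtain ⟨J, hJ⟩ := exists_lookup_eq h n
    refine ⟨J, ?_⟩
    simp only [preswap, unpair_query, dec_query, length_pre]
    exact hJ _ _ J le_rfl (fun m hm => pad_pre_of_lt v (hm.trans_le (le_query n y J))) (hs J)

/-- The initial segment of the output of `p` on input `q` that is found in `m` steps if every
digit may use `k` digits of the input. -/
def known (p q : Baire) (k m : ℕ) : List ℕ :=
  Nat.rec [] (fun _ l => bif lookup p q l.length k == 0 then l
    else l ++ [lookup p q l.length k - 1]) m

lemma known_succ (p q : Baire) (k m : ℕ) : known p q k (m + 1) =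
    if lookup p q (known p q k m).length k = 0 then known p q k m
    else known p q k m ++ [lookup p q (known p q k m).length k - 1] := by
  change (bif lookup p q (known p q k m).length k == 0 then known p q k m
    else known p q k m ++ [lookup p q (known p q k m).length k - 1]) = _
  simp [Bool.cond_eq_ite]

lemma known_eq {p q r : Baire} {k L : ℕ}
    (h : ∀ n, lookup p q n k = 0 ∨ lookup p q n k = r n + 1)
    (hL : ∀ n < L, lookup p q n k ≠ 0) (m : ℕ) :
    ∃ l, known p q k m = pre r l ∧ min m L ≤ l := by
  induction m with
  | zero => exact ⟨0, rfl, by simp⟩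
  | succ m ih =>
    obtain ⟨l, hl, hml⟩ := ih
    rw [known_succ, hl, length_pre]
    split_ifs with h0
    -- The search stalls only at a digit not yet found, and all digits below `L` can be found.
    · have : L ≤ l := not_lt.1 fun hlt => hL l hlt h0
      exact ⟨l, rfl, by omega⟩
    · refine ⟨l + 1, ?_, by omega⟩
      rw [pre_succ, (h l).resolve_left h0, Nat.add_sub_cancel]

/-- An associate of the composition of the functions with associates `p` and `p'`. -/
def compAssoc (p p' : Baire) : Baire := fun m =>
  lookup p' (pad (known p (pad (dec m)) (dec m).length (dec m).length)) m.unpair.1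
    (known p (pad (dec m)) (dec m).length (dec m).length).length

lemma mem_kleeneApp_compAssoc {p p' q r s : Baire} (hr : r ∈ kleeneApp p q)
    (hs : s ∈ kleeneApp p' r) : s ∈ kleeneApp (compAssoc p p') q := by
  have ha : ∀ k n, lookup p (pad (pre q k)) n k = 0 ∨ lookup p (pad (pre q k)) n k = r n + 1 :=
    fun k n => lookup_approx hr (fun _ => .inl rfl) fun i hi => pad_pre_of_lt q hi
  refine mem_kleeneApp fun n => ⟨fun k => ?_, ?_⟩
  · simp only [compAssoc, unpair_query, dec_query, length_pre]
    obtain ⟨l, hl, -⟩ := known_eq (L := 0) (ha k) (by simp) k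
    rw [hl, length_pre]
    exact lookup_approx hs (fun _ => .inl rfl) fun i hi => pad_pre_of_lt r hi
  · obtain ⟨J, hJ⟩ := exists_lookup_eq hs n
    choose N hN using exists_lookup_eq hr
    -- The supremum makes the first `J` digits of `r` available; the summand `J` allows enough steps
    -- to collect them.
    refine ⟨J + (Finset.range J).sup N, ?_⟩
    set k := J + (Finset.range J).sup N with hk
    obtain ⟨l, hl, hlJ⟩ := known_eq (L := J) (ha k) (fun i hi => by
      have hle : N i ≤ (Finset.range J).sup N := Finset.le_sup (Finset.mem_range.2 hi)
      rw [hN i p _ k (by omega) (fun _ _ => rfl) fun j hj => pad_pre_of_lt q (by omega)]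
      simp) k
    simp only [compAssoc, unpair_query, dec_query, length_pre]
    rw [hl, length_pre]
    exact hJ _ _ l (by omega) (fun _ _ => rfl) fun i hi => pad_pre_of_lt r (by omega)

/-- An associate of the total function `u ↦ (Φ (pre u m) m)ₘ`. -/
def causalAssoc (Φ : List ℕ → ℕ → ℕ) : Baire := fun m =>
  bif decide (m.unpair.1 ≤ (dec m).length)
    then Φ (pre (pad (dec m)) m.unpair.1) m.unpair.1 + 1 else 0

lemma mem_kleeneApp_causalAssoc (Φ : List ℕ → ℕ → ℕ) (u : Baire) :
    (fun m => Φ (pre u m) m) ∈ kleeneApp (causalAssoc Φ) u := by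
  have h : ∀ n k, causalAssoc Φ (query n u k) = if n ≤ k then Φ (pre u n) n + 1 else 0 := by
    intro n k
    simp only [causalAssoc, unpair_query, dec_query, length_pre, Bool.cond_decide]
    split_ifs with hnk
    -- Cutting the prefix to `n` digits makes the answer independent of `k`.
    · rw [pre_congr fun i hi => pad_pre_of_lt u (hi.trans_le hnk)]
    · rfl
  refine mem_kleeneApp fun n => ⟨fun k => ?_, n, ?_⟩
  · rw [h]
    split_ifs <;> simp
  · rw [h, if_pos le_rfl]

end Associates

/-! ### Computability of the associates -/

section Computability

variable {α : Type*} [Primcodable α]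

lemma computable_pre {Q : α → Baire} {k : α → ℕ} (hQ : Computable₂ Q) (hk : Computable k) :
    Computable fun a => pre (Q a) (k a) := by
  have h : Computable₂ fun (a : α) (z : ℕ × List ℕ) => z.2 ++ [Q a z.1] :=
    Computable.list_concat.comp (Computable.snd.comp Computable.snd)
      (hQ.comp Computable.fst (Computable.fst.comp Computable.snd))
  refine (Computable.nat_rec hk (Computable.const []) h).of_eq fun a => ?_
  induction k a with
  | zero => rfl
  | succ k ih => rw [pre_succ, ← ih]

lemma computable_pad : Computable₂ pad := (Primrec.list_getD 0).to_comp

lemma computable_fst_unpair : Computable fun m : ℕ => m.unpair.1 :=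
  Computable.fst.comp Computable.unpair

lemma computable_dec : Computable dec :=
  Computable.option_getD (Computable.decode.comp (Computable.snd.comp Computable.unpair))
    (Computable.const [])

lemma computable_query {n k : α → ℕ} {Q : α → Baire} (hn : Computable n) (hQ : Computable₂ Q)
    (hk : Computable k) : Computable fun a => query (n a) (Q a) (k a) :=
  (Primrec₂.natPair.to_comp).comp hn (Computable.encode.comp (computable_pre hQ hk))

lemma computable_eq_zero {f : α → ℕ} (hf : Computable f) : Computable fun a => f a == 0 :=
  (Primrec.beq (α := ℕ)).to_comp.comp hf (Computable.const 0)

lemma computable_lookup {P Q : α → Baire} {n k : α → ℕ} (hP : Computable₂ P)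
    (hQ : Computable₂ Q) (hn : Computable n) (hk : Computable k) :
    Computable fun a => lookup (P a) (Q a) (n a) (k a) := by
  refine Computable.nat_rec (h := fun a (z : ℕ × ℕ) =>
    bif z.2 == 0 then P a (query (n a) (Q a) (z.1 + 1)) else z.2) hk
    (hP.comp Computable.id (computable_query hn hQ (Computable.const 0))) ?_
  refine Computable.cond (computable_eq_zero (Computable.snd.comp Computable.snd)) ?_
    (Computable.snd.comp Computable.snd)
  refine hP.comp Computable.fst (computable_query (hn.comp Computable.fst) ?_
    (Computable.succ.comp (Computable.fst.comp Computable.snd)))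
  exact hQ.comp (Computable.fst.comp Computable.fst) Computable.snd

lemma computable_known {P Q : α → Baire} {k m : α → ℕ} (hP : Computable₂ P)
    (hQ : Computable₂ Q) (hk : Computable k) (hm : Computable m) :
    Computable fun a => known (P a) (Q a) (k a) (m a) := by
  have hl : Computable fun z : α × ℕ × List ℕ =>
      lookup (P z.1) (Q z.1) z.2.2.length (k z.1) :=
    computable_lookup (hP.comp (Computable.fst.comp Computable.fst) Computable.snd)
      (hQ.comp (Computable.fst.comp Computable.fst) Computable.snd)
      (Computable.list_length.comp (Computable.snd.comp Computable.snd))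
      (hk.comp Computable.fst)
  refine Computable.nat_rec (h := fun a (z : ℕ × List ℕ) =>
    bif lookup (P a) (Q a) z.2.length (k a) == 0 then z.2
    else z.2 ++ [lookup (P a) (Q a) z.2.length (k a) - 1]) hm (Computable.const []) ?_
  exact Computable.cond (computable_eq_zero hl) (Computable.snd.comp Computable.snd)
    (Computable.list_concat.comp (Computable.snd.comp Computable.snd)
      (Computable.pred.comp hl))

lemma computable_compAssoc {p p' : Baire} (hp : Computable p) (hp' : Computable p') :
    Computable (compAssoc p p') := by
  have hlen : Computable fun m => (dec m).length := Computable.list_length.comp computable_dec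
  have hk := computable_known (P := fun _ => p) (Q := fun m => pad (dec m))
    (hp.comp Computable.snd) (computable_pad.comp (computable_dec.comp Computable.fst)
      Computable.snd) hlen hlen
  exact computable_lookup (P := fun _ => p') (hp'.comp Computable.snd)
    (computable_pad.comp (hk.comp Computable.fst) Computable.snd) computable_fst_unpair
    (Computable.list_length.comp hk)

lemma computable_causalAssoc {Φ : List ℕ → ℕ → ℕ} (hΦ : Computable₂ Φ) :
    Computable (causalAssoc Φ) := by
  have hle : Computable fun m : ℕ => decide (m.unpair.1 ≤ (dec m).length) :=
    (PrimrecPred.decide (Primrec.nat_le.comp Primrec.fst Primrec.snd)).to_comp.comp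
      (computable_fst_unpair.pair (Computable.list_length.comp computable_dec))
  refine Computable.cond hle (Computable.succ.comp (hΦ.comp (computable_pre ?_
    computable_fst_unpair) computable_fst_unpair)) (Computable.const 0)
  exact computable_pad.comp (computable_dec.comp Computable.fst) Computable.snd

/-- `Computable` applies to coded data only, so a finite list stands in for the sequence; causality
makes this enough. -/
lemma computable_swap_pad : Computable₂ fun w : List ℕ => swap (pad w) := by
  have hd : Computable fun z : List ℕ × ℕ => dec z.2 := computable_dec.comp Computable.snd
  refine computable_lookup (P := fun z : List ℕ × ℕ => pad (dec z.2))
    (Q := fun z => pad (pre (pad z.1) z.2)) (n := fun z => z.2.unpair.1)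
    (computable_pad.comp (hd.comp Computable.fst) Computable.snd) ?_
    (computable_fst_unpair.comp Computable.snd) (Computable.list_length.comp hd)
  exact computable_pad.comp ((computable_pre (Q := fun z : List ℕ × ℕ => pad z.1)
    (computable_pad.comp (Computable.fst.comp Computable.fst) Computable.snd)
    Computable.snd).comp Computable.fst) Computable.snd

lemma computable_preswap_pad : Computable₂ fun w : List ℕ => preswap (pad w) := by
  have hd : Computable fun z : List ℕ × ℕ => dec z.2 := computable_dec.comp Computable.snd
  refine computable_lookup (P := fun z : List ℕ × ℕ => pad (pre (pad z.1) z.2))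
    (Q := fun z => swap (pad (dec z.2))) (n := fun z => z.2.unpair.1) ?_
    (computable_swap_pad.comp (hd.comp Computable.fst) Computable.snd)
    (computable_fst_unpair.comp Computable.snd) (Computable.list_length.comp hd)
  exact computable_pad.comp ((computable_pre (Q := fun z : List ℕ × ℕ => pad z.1)
    (computable_pad.comp (Computable.fst.comp Computable.fst) Computable.snd)
    Computable.snd).comp Computable.fst) Computable.snd

lemma exists_assoc_swap : ∃ p : Baire, Computable p ∧ ∀ u, swap u ∈ kleeneApp p u := by
  refine ⟨_, computable_causalAssoc computable_swap_pad, fun u => ?_⟩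
  convert mem_kleeneApp_causalAssoc (fun w m => swap (pad w) m) u using 1
  exact funext fun m => swap_congr fun i hi => (pad_pre_of_lt u hi).symm

lemma exists_assoc_preswap : ∃ p : Baire, Computable p ∧ ∀ v, preswap v ∈ kleeneApp p v := by
  refine ⟨_, computable_causalAssoc computable_preswap_pad, fun v => ?_⟩
  convert mem_kleeneApp_causalAssoc (fun w m => preswap (pad w) m) v using 1
  funext m
  exact congrArg (fun w => lookup (pad w) (swap (pad (dec m))) m.unpair.1 (dec m).length)
    (pre_congr fun i hi => (pad_pre_of_lt v hi).symm)

end Computability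

/-! ### Realizers given by associates -/

section Realizers

variable {X Y : Type*} [Represented X] [Represented Y]

lemma isComputableMulti_iff {f : X → Set Y} :
    IsComputableMulti f ↔ ∃ p : Baire, Computable p ∧ Realizes (kleeneApp p) f := by
  constructor
  · rintro ⟨F, ⟨p, hp, hpF⟩, hF⟩
    refine ⟨p, hp, fun q x hq hx => ?_⟩
    obtain ⟨r, hr, h⟩ := hF q x hq hx
    exact ⟨r, hpF q r hr, h⟩
  · rintro ⟨p, hp, hpf⟩
    exact ⟨_, ⟨p, hp, fun _ _ h => h⟩, hpf⟩

lemma IsComputableMap.exists_assoc {f : X → Y} (hf : IsComputableMap f) :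
    ∃ p : Baire, Computable p ∧ ∀ q x, IsName q x → ∃ r ∈ kleeneApp p q, IsName r (f x) := by
  obtain ⟨p, hp, h⟩ := isComputableMulti_iff.1 hf
  refine ⟨p, hp, fun q x hq => ?_⟩
  obtain ⟨r, hr, _, rfl, hry⟩ := h q x hq ⟨_, rfl⟩
  exact ⟨r, hr, hry⟩

lemma isName_OO_iff {p : Baire} {U : OO X} : IsName p U ↔
    ∀ q x, IsName q x → ∃ r ∈ kleeneApp p q, (x ∈ U ↔ ∃ n, r n ≠ 0) := by
  constructor
  · intro h q x hq
    obtain ⟨r, hr, _, rfl, h'⟩ := h q x hq ⟨_, rfl⟩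
    exact ⟨r, hr, h'⟩
  · intro h q x hq _
    obtain ⟨r, hr, h'⟩ := h q x hq
    exact ⟨r, hr, _, rfl, h'⟩

/-- A set whose characteristic function is realized by a continuous function is open. -/
lemma isOpen_of_assoc {p : Baire} {U : Set X}
    (h : ∀ q x, IsName q x → ∃ r ∈ kleeneApp p q, (x ∈ U ↔ ∃ n, r n ≠ 0)) :
    IsOpen[finalTopology X] U := by
  rw [isOpen_final_iff]
  intro q x hq hx
  obtain ⟨r, hr, hrx⟩ := h q x hq
  obtain ⟨n, hn⟩ := hrx.1 hx
  filter_upwards [(kleeneApp_eventually hr n).curry.self_of_nhds] with q' hq' x' hx'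
  obtain ⟨r', hr', hrx'⟩ := h q' x' hx'
  exact hrx'.2 ⟨n, by rwa [hq' r' hr']⟩

/-- Composing a realizer of `f` with a name of `U` realizes the characteristic function of the
preimage. -/
lemma isOpen_preimage {f : X → OO Y} (hf : IsComputableMap f) (U : OO (OO Y)) :
    IsOpen[finalTopology X] {x | f x ∈ U} := by
  obtain ⟨p, -, hp⟩ := hf.exists_assoc
  obtain ⟨u, hu⟩ := Represented.surj U
  refine isOpen_of_assoc (p := compAssoc p u) fun q x hq => ?_
  obtain ⟨r, hr, hrx⟩ := hp q x hq
  obtain ⟨s, hs, hsx⟩ := isName_OO_iff.1 hu r _ hrx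
  exact ⟨s, mem_kleeneApp_compAssoc hr hs, hsx⟩

end Realizers

/-! ### Boxes, points and unions in the hyperspaces -/

section Hyperspaces

variable {X : Type*} [Represented X]

lemma isName_FF {k : Baire} {K : KK X} (hk : IsName k K) : IsName k (FF K) := hk

lemma exists_mem_kleeneApp_swap {u k : Baire} {U : OO X} {K : KK X} (hu : IsName u U)
    (hk : IsName k K) : ∃ r ∈ kleeneApp (swap u) k, ((∀ x ∈ K, x ∈ U) ↔ ∃ n, r n ≠ 0) := by
  obtain ⟨r, hr, h⟩ := isName_OO_iff.1 (isName_FF hk) u U hu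
  exact ⟨r, mem_kleeneApp_swap hr, h⟩

/-- The open set of all saturated compact subsets of an open set. -/
def box (U : OO X) : OO (KK X) where
  carrier := {K | ∀ x ∈ K, x ∈ U}
  isOpen := by
    obtain ⟨u, hu⟩ := Represented.surj U
    exact isOpen_of_assoc fun k K hk => exists_mem_kleeneApp_swap hu hk

lemma isName_swap_box {u : Baire} {U : OO X} (hu : IsName u U) : IsName (swap u) (box U) :=
  isName_OO_iff.2 fun _ _ hk => exists_mem_kleeneApp_swap hu hk

/-- Evaluation at `x` is both the universal quantifier over the saturation of `{x}` and the
existential quantifier over its closure, so the same name serves both. -/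
lemma isName_swap {q : Baire} {x : X} {W : OO (OO X)} (hq : IsName q x)
    (hW : ∀ U, U ∈ W ↔ x ∈ U) : IsName (swap q) W := by
  refine isName_OO_iff.2 fun u U hu => ?_
  obtain ⟨r, hr, h⟩ := isName_OO_iff.1 hu q x hq
  exact ⟨r, mem_kleeneApp_swap hr, (hW U).trans h⟩

/-- The saturation of a compact set. -/
def KK.saturation (S : Set X) (hS : @IsCompact X (finalTopology X) S) : KK X where
  carrier := @nhdsKer X (finalTopology X) S
  isCompact := by
    let _ := finalTopology X
    exact IsCompact.nhdsKer_iff.2 hS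
  saturated x h := by
    let _ := finalTopology X
    exact mem_nhdsKer.2 fun U hU hSU => h U hU (hU.nhdsKer_subset.2 hSU)

lemma KK.forall_mem_saturation {S : Set X} {hS : @IsCompact X (finalTopology X) S} {U : OO X} :
    (∀ x ∈ KK.saturation S hS, x ∈ U) ↔ ∀ x ∈ S, x ∈ U := by
  let _ := finalTopology X
  exact U.isOpen.nhdsKer_subset

/-- The saturation of a point. -/
def KK.point (x : X) : KK X :=
  KK.saturation {x} (@isCompact_singleton X (finalTopology X) x)

lemma KK.point_mem_box {x : X} {U : OO X} : KK.point x ∈ box U ↔ x ∈ U :=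
  KK.forall_mem_saturation.trans (by simp)

lemma isName_swap_point {q : Baire} {x : X} (hq : IsName q x) : IsName (swap q) (KK.point x) :=
  isName_swap (W := FF (KK.point x)) hq fun _ => KK.point_mem_box

lemma isName_preswap {v : Baire} {U : OO X} (hv : IsName v (box U)) : IsName (preswap v) U := by
  refine isName_OO_iff.2 fun q x hq => ?_
  obtain ⟨r, hr, h⟩ := isName_OO_iff.1 hv _ _ (isName_swap_point hq)
  exact ⟨r, mem_kleeneApp_preswap hr, KK.point_mem_box.symm.trans h⟩

lemma isCompact_iUnion_KK (𝒦 : KK (KK X)) :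
    @IsCompact X (finalTopology X) (⋃ K ∈ 𝒦.carrier, KK.carrier K) := by
  let _ := finalTopology X
  refine isCompact_of_finite_subcover fun U hU hcov => ?_
  let V : Finset _ → OO X := fun t => ⟨⋃ i ∈ t, U i, isOpen_biUnion fun i _ => hU i⟩
  have hV : Monotone fun t => (V t).carrier := fun s t hst =>
    Set.biUnion_subset_biUnion_left hst
  let _ := finalTopology (KK X)
  -- Each `K ∈ 𝒦` is covered by finitely many `U i`, so the boxes of finite unions form a directed
  -- open cover of `𝒦`.
  obtain ⟨t, ht⟩ := 𝒦.isCompact.elim_directed_cover (fun t => (box (V t)).carrier)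
    (fun t => (box (V t)).isOpen)
    (fun K hK => by
      obtain ⟨t, ht⟩ := K.isCompact.elim_finite_subcover U hU
        ((Set.subset_biUnion_of_mem hK).trans hcov)
      exact Set.mem_iUnion.2 ⟨t, ht⟩)
    (Monotone.directed_le fun s t hst K hK x hx => hV hst (hK x hx))
  exact ⟨t, Set.iUnion₂_subset fun K hK x hx => ht hK x hx⟩

/-- The saturation of the union of a compact set of compact sets. -/
def KK.union (𝒦 : KK (KK X)) : KK X := KK.saturation _ (isCompact_iUnion_KK 𝒦)

lemma KK.union_mem_box {𝒦 : KK (KK X)} {U : OO X} :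
    KK.union 𝒦 ∈ box U ↔ ∀ K ∈ 𝒦, K ∈ box U := by
  refine KK.forall_mem_saturation.trans ⟨fun h K hK x hx => ?_, fun h x hx => ?_⟩
  · exact h x (Set.mem_biUnion hK hx)
  · obtain ⟨K, hK, hx⟩ := Set.mem_iUnion₂.1 hx
    exact h K hK x hx

/-- The union lies in `U` iff `𝒦` lies in `box U`, so its quantifier is that of `𝒦` precomposed with
`box`, which `swap` realizes. -/
lemma isName_preswap_union {p : Baire} {𝒦 : KK (KK X)} (hp : IsName p 𝒦) :
    IsName (preswap p) (KK.union 𝒦) := by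
  refine (isName_OO_iff (U := FF (KK.union 𝒦))).2 fun u U hu => ?_
  obtain ⟨r, hr, h⟩ := isName_OO_iff.1 (isName_FF hp) _ _ (isName_swap_box hu)
  exact ⟨r, mem_kleeneApp_preswap hr, KK.union_mem_box.trans h⟩

/-- The closure of a point. -/
def AA.point (x : X) : AA X :=
  ⟨@closure X (finalTopology X) {x}, @isClosed_closure X (finalTopology X) {x}⟩

lemma AA.exists_mem_point {x : X} {U : OO X} : (∃ y ∈ AA.point x, y ∈ U) ↔ x ∈ U := by
  let _ := finalTopology X
  constructor
  · rintro ⟨y, hy, hyU⟩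
    exact (specializes_iff_mem_closure.2 hy).mem_open U.isOpen hyU
  · exact fun h => ⟨x, subset_closure rfl, h⟩

lemma isName_swap_closure_point {q : Baire} {x : X} (hq : IsName q x) : IsName (swap q) (AA.point x) :=
  isName_swap (W := TT (AA.point x)) hq fun _ => AA.exists_mem_point

end Hyperspaces

/-! ### The embedding and the closed-set selector -/

section Presubbases

variable {X Y : Type*} [Represented X] [Represented Y]

lemma isComputableEmbedding_box {f : X → OO Y} (hf : IsComputableEmbedding f) :
    IsComputableEmbedding fun x => box (f x) := by
  have hbox : Function.Injective (box (X := Y)) := fun U V h => by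
    refine OO.ext (Set.ext fun y => ?_)
    change y ∈ U ↔ y ∈ V
    rw [← KK.point_mem_box, h, KK.point_mem_box]
  obtain ⟨hinj, hcomp, hinv⟩ := hf
  refine ⟨hbox.comp hinj, isComputableMulti_iff.2 ?_, isComputableMulti_iff.2 ?_⟩
  · obtain ⟨p, hp, hpf⟩ := hcomp.exists_assoc
    obtain ⟨t, ht, htu⟩ := exists_assoc_swap
    refine ⟨_, computable_compAssoc hp ht, fun q x hq _ => ?_⟩
    obtain ⟨r, hr, hrx⟩ := hpf q x hq
    exact ⟨_, mem_kleeneApp_compAssoc hr (htu r), _, rfl, isName_swap_box hrx⟩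
  · obtain ⟨p, hp, hpf⟩ := isComputableMulti_iff.1 hinv
    obtain ⟨t, ht, htv⟩ := exists_assoc_preswap
    refine ⟨_, computable_compAssoc ht hp, ?_⟩
    rintro v _ hv ⟨x, rfl⟩
    obtain ⟨r, hr, x', hx', hrx⟩ := hpf _ _ (isName_preswap hv) ⟨x, rfl⟩
    exact ⟨r, mem_kleeneApp_compAssoc (htv v) hr, x', congrArg box hx', hrx⟩

lemma isComputableMap_closure_union :
    IsComputableMap fun 𝒦 : KK (KK X) => AA.point (KK.union 𝒦) := by
  obtain ⟨s, hs, hsu⟩ := exists_assoc_swap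
  obtain ⟨t, ht, htv⟩ := exists_assoc_preswap
  refine isComputableMulti_iff.2 ⟨_, computable_compAssoc ht hs, fun p 𝒦 hp _ => ?_⟩
  exact ⟨_, mem_kleeneApp_compAssoc (htv p) (hsu _), _, rfl,
    isName_swap_closure_point (isName_preswap_union hp)⟩

end Presubbases

end RepSp

/-! ### The proposition -/

theorem proposition19 {X Y : Type*} [Represented X] [Represented Y] (B : Y → OO X)
    (hB : IsComputablePresubbase B) :
    ∃ h : ∀ K : KK Y, IsOpen[finalTopology X] (⋂ y ∈ K, (B y).carrier),
      IsComputablePrebase (fun K : KK Y => (⟨⋂ y ∈ K, (B y).carrier, h K⟩ : OO X)) := by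
  obtain ⟨hopen, he⟩ := hB
  set e : X → OO Y := fun x => ⟨{y | x ∈ B y}, hopen x⟩
  have hmem : ∀ (K : KK Y) x, x ∈ ⋂ y ∈ K, (B y).carrier ↔ K ∈ box (e x) :=
    fun K x => Set.mem_iInter₂
  have hbox : ∀ x, {K : KK Y | x ∈ ⋂ y ∈ K, (B y).carrier} = (box (e x)).carrier :=
    fun x => Set.ext fun K => hmem K x
  have h : ∀ K : KK Y, IsOpen[finalTopology X] (⋂ y ∈ K, (B y).carrier) := fun K => by
    rw [show (⋂ y ∈ K, (B y).carrier) = {x | e x ∈ FF K} from Set.ext (hmem K)]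
    exact isOpen_preimage he.2.1 (FF K)
  refine ⟨h, ⟨fun x => ?_, ?_⟩, ⟨_, fun _ => Set.singleton_nonempty _,
    isComputableMap_closure_union, ?_⟩, ?_⟩
  · change IsOpen[finalTopology (KK Y)] {K : KK Y | x ∈ ⋂ y ∈ K, (B y).carrier}
    rw [hbox]
    exact (box (e x)).isOpen
  · convert isComputableEmbedding_box he using 1
    exact funext fun x => OO.ext (hbox x)
  · rintro 𝒦 _ rfl
    ext x
    have h1 : (x ∈ ⋂ K ∈ 𝒦, ⋂ y ∈ K, (B y).carrier) ↔ ∀ K ∈ 𝒦, K ∈ box (e x) :=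
      Set.mem_iInter₂.trans (forall₂_congr fun K _ => hmem K x)
    have h2 : (x ∈ ⋃ K ∈ AA.point (KK.union 𝒦), ⋂ y ∈ K, (B y).carrier) ↔
        ∃ K ∈ AA.point (KK.union 𝒦), K ∈ box (e x) := by
      simp only [Set.mem_iUnion, exists_prop, hmem]
    exact h1.trans (KK.union_mem_box.symm.trans (AA.exists_mem_point.symm.trans h2.symm))
  · let _ := finalTopology Y
    -- The index with empty intersection: it lies in every box, so its basic open set is all of `X`.
    refine Set.eq_univ_of_forall fun x => Set.mem_iUnion.2 ⟨KK.saturation ∅ isCompact_empty, ?_⟩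
    exact (hmem _ x).2 (KK.forall_mem_saturation.2 fun y hy => absurd hy (Set.notMem_empty y))
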